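/- Let $n\ge 3$ and consider a finite classical polar space of rank $n$ with parameter $e$ over $\mathbb F_q$, i.e. the geometry of nonzero totally singular subspaces of one of the following nondegenerate forms of Witt index $n$ on an $\mathbb F_q$-vector space $V$ (with $q$ a square in the hermitian cases): a quadratic form with $\dim V=2n$ ($e=0$), $2n+1$ ($e=1$) or $2n+2$ ($e=2$); a symplectic form with $\dim V=2n$ ($e=1$); a hermitian form with $\dim V=2n$ ($e=\tfrac12$) or $2n+1$ ($e=\tfrac32$). A subspace of type $k$ is a totally singular subspace of vector space dimension $k$; points are those of type $1$, generators those of type $n$. For $J\subseteq\{1,\dots,n\}$, a flag of type $J$ is a set of pairwise incident subspaces whose set of types is $J$; let $v_J$ be the number of flags of type $J$. A polar frame is a set of points $\{e_{\pm1},\dots,e_{\pm n}\}$ such that each $e_i$ is collinear with every $e_j$ except $e_{-i}$. Two maximal flags (flags of type $\{1,\dots,n\}$) are opposite if they are $\{\langle e_1\rangle,\langle e_1,e_2\rangle,\dots,\langle e_1,\dots,e_n\rangle\}$ and $\{\langle e_{-1}\rangle,\langle e_{-1},e_{-2}\rangle,\dots,\langle e_{-1},\dots,e_{-n}\rangle\}$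 for some polar frame (equivalently, their relative position under the isometry group is the longest element of the Weyl group of type $B_n$); two flags of type $J$ are opposite if they extend to opposite maximal flags. A set of flags of type $J$ is an EKR-set if no two of its flags are opposite. Let $$b_J=\begin{cases}\dfrac{v_J}{1+q^{n/2}} & \text{if } e=\tfrac12,\ n \text{ odd},\ n\in J,\\[2mm] \dfrac{v_J}{2} & \text{if } e=0,\ n\text{ odd},\ n\in J,\\[2mm] \dfrac{v_J}{1+q^{n+e-1}} & \text{otherwise.}\end{cases}$$ (This is the value of a known upper bound for the size of EKR-sets of flags of type $J$.) Theorem. (i) If $1\in J$ and $C$ is the set of all flags of type $J$ whose point lies in a fixed generator, then $C$ is an EKR-set and $|C|=\dfrac{v_J}{1+q^{n+e-1}}$. In particular $|C|=b_J$ if $e\ge 1$, or $n$ is even, or $n\notin J$. (ii) If $n\in J$, and $e\ge 1$ or $n$ is even, and $C$ is the set of all flags of type $J$ whose generator passes through a fixed point, then $C$ is an EKR-set and $|C|=b_J$. (iii) If $n\in J$, $e=0$ and $n$ is odd, and $C$ is the set of all flags of type $J$ whose generator lies in a fixed class of generators, then $C$ is an EKR-set and $|C|=b_J$. Here a class of generators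 is a set of the form $\{N \text{ a generator} : \dim(N\cap N_0)\equiv n \pmod 2\}$ for a generator $N_0$. -/

import Mathlib

/-- A nondegenerate reflexive form on a vector space `V` over `F`, of one of the three kinds that
define the classical polar spaces. -/
inductive PolarForm (F V : Type*) [Field F] [AddCommGroup V] [Module F V] where
  /-- A nondegenerate alternating bilinear form. -/
  | symplectic (B : V →ₗ[F] V →ₗ[F] F) (alt : ∀ x, B x x = 0)
      (nondeg : ∀ x, (∀ y, B x y = 0) → x = 0) : PolarForm F V
  /-- A nondegenerate hermitian form with respect to an involution `σ ≠ 1` of the field. -/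
  | hermitian (σ : F →+* F) (invol : ∀ a, σ (σ a) = a) (nontriv : σ ≠ RingHom.id F)
      (H : V →ₛₗ[σ] V →ₗ[F] F) (symm : ∀ x y, σ (H x y) = H y x)
      (nondeg : ∀ x, (∀ y, H x y = 0) → x = 0) : PolarForm F V
  /-- A nondegenerate quadratic form (any characteristic): the radical of its polar form contains
  no nonzero singular vector. -/
  | quadratic (Q : QuadraticForm F V)
      (nondeg : ∀ x, Q x = 0 → (∀ y, QuadraticMap.polar Q x y = 0) → x = 0) : PolarForm F V

namespace PolarForm

variable {F V : Type*} [Field F] [AddCommGroup V] [Module F V]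

/-- A vector is singular if the form vanishes on it. -/
def Singular : PolarForm F V → V → Prop
  | symplectic B _ _, x => B x x = 0
  | hermitian _ _ _ H _ _, x => H x x = 0
  | quadratic Q _, x => Q x = 0

/-- Orthogonality of two vectors. -/
def Perp : PolarForm F V → V → V → Prop
  | symplectic B _ _, x, y => B x y = 0
  | hermitian _ _ _ H _ _, x, y => H x y = 0
  | quadratic Q _, x, y => QuadraticMap.polar Q x y = 0

/-- The elements of the isometry group of the form. -/
def IsIsometry : PolarForm F V → (V ≃ₗ[F] V) → Prop
  | symplectic B _ _, g => ∀ x y, B (g x) (g y) = B x y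
  | hermitian _ _ _ H _ _, g => ∀ x y, H (g x) (g y) = H x y
  | quadratic Q _, g => ∀ x, Q (g x) = Q x

/-- The totally singular (totally isotropic) subspaces are the subspaces of the polar space. -/
def TotallySingular (P : PolarForm F V) (U : Submodule F V) : Prop :=
  (∀ x ∈ U, P.Singular x) ∧ ∀ x ∈ U, ∀ y ∈ U, P.Perp x y

/-- A subspace of type `k`: a totally singular subspace of vector space dimension `k`. -/
def IsSubspaceOfType (P : PolarForm F V) (k : ℕ) (U : Submodule F V) : Prop :=
  P.TotallySingular U ∧ Module.finrank F U = k

/-- The polar space has rank `n`: this is the largest dimension of a totally singular subspace. -/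
def HasRank (P : PolarForm F V) (n : ℕ) : Prop :=
  (∃ U, P.IsSubspaceOfType n U) ∧ ∀ U, P.TotallySingular U → Module.finrank F U ≤ n

/-- The values of the parameter `e` for the six families of polar spaces of rank `n`:
`Sp(2n)`; `U(2n)` and `U(2n+1)`; `O⁺(2n)`, `O(2n+1)` and `O⁻(2n+2)`. -/
def HasParameter : PolarForm F V → ℕ → ℝ → Prop
  | symplectic _ _ _, n, e => Module.finrank F V = 2 * n ∧ e = 1
  | hermitian _ _ _ _ _ _, n, e =>
      (Module.finrank F V = 2 * n ∧ e = 1 / 2) ∨ (Module.finrank F V = 2 * n + 1 ∧ e = 3 / 2)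
  | quadratic _ _, n, e =>
      (Module.finrank F V = 2 * n ∧ e = 0) ∨ (Module.finrank F V = 2 * n + 1 ∧ e = 1) ∨
        (Module.finrank F V = 2 * n + 2 ∧ e = 2)

/-- `P` defines a classical polar space of rank `n` with parameter `e`. -/
def IsPolarSpace (P : PolarForm F V) (n : ℕ) (e : ℝ) : Prop :=
  P.HasRank n ∧ P.HasParameter n e

/-- A flag of type `J`: a set of pairwise incident subspaces of the polar space, whose set of
dimensions is `J`. -/
def IsFlag (P : PolarForm F V) (J : Set ℕ) (f : Set (Submodule F V)) : Prop :=
  (∀ U ∈ f, P.TotallySingular U) ∧ IsChain (· ≤ ·) f ∧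
    (fun U : Submodule F V => Module.finrank F U) '' f = J

/-- Two points are collinear (possibly equal) if they are orthogonal. -/
def Collinear (P : PolarForm F V) (p r : Submodule F V) : Prop :=
  ∀ x ∈ p, ∀ y ∈ r, P.Perp x y

/-- The index set `{-n, …, -1, 1, …, n}` on which the hyperoctahedral group acts: `(i, 1)` and
`(i, -1)` stand for `i + 1` and `-(i + 1)`. -/
abbrev SignedIndex (n : ℕ) : Type := Fin n × ℤˣ

/-- The longest element `(-n, n) ⋯ (-1, 1)` of the Weyl group of type `B_n`, acting on the signed
indices. -/
def longest (n : ℕ) : Equiv.Perm (SignedIndex n) :=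
  (Equiv.refl (Fin n)).prodCongr (Equiv.neg ℤˣ)

/-- A polar frame: `2n` points such that each is collinear to all of them except its opposite. -/
def IsPolarFrame (P : PolarForm F V) (n : ℕ) (E : SignedIndex n → Submodule F V) : Prop :=
  (∀ i, P.IsSubspaceOfType 1 (E i)) ∧
    ∀ i j, P.Collinear (E i) (E j) ↔ j ≠ longest n i

/-- The maximal flag `w · {⟨e₁⟩, ⟨e₁, e₂⟩, …, ⟨e₁, …, eₙ⟩}` attached to a frame and a permutation
`w` of the signed indices. -/
def frameFlag {n : ℕ} (E : SignedIndex n → Submodule F V) (w : Equiv.Perm (SignedIndex n)) :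
    Set (Submodule F V) :=
  {U | ∃ k : Fin n, U = ⨆ i : Fin n, ⨆ _ : i ≤ k, E (w (i, 1))}

/-- Opposition of maximal flags: the orbit of `(F, w₀ F)` under the isometry group, where `F` is
the maximal flag of a polar frame and `w₀` is the longest element of the Weyl group. All polar
frames are conjugate, so the choice of the frame is immaterial. -/
def OppositeMaximal (P : PolarForm F V) (n : ℕ) (f₁ f₂ : Set (Submodule F V)) : Prop :=
  ∃ E : SignedIndex n → Submodule F V, P.IsPolarFrame n E ∧
    ∃ g : V ≃ₗ[F] V, P.IsIsometry g ∧
      f₁ = Submodule.map (g : V →ₗ[F] V) '' frameFlag E 1 ∧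
      f₂ = Submodule.map (g : V →ₗ[F] V) '' frameFlag E (longest n)

/-- Opposition of two flags of type `J`: they extend to opposite maximal flags. (The longest
element is central in type `B_n`, so a flag can only be opposite to a flag of the same type.) -/
def Opposite (P : PolarForm F V) (n : ℕ) (J : Set ℕ) (f₁ f₂ : Set (Submodule F V)) : Prop :=
  P.IsFlag J f₁ ∧ P.IsFlag J f₂ ∧
    ∃ m₁ m₂, P.IsFlag (Set.Icc 1 n) m₁ ∧ P.IsFlag (Set.Icc 1 n) m₂ ∧ f₁ ⊆ m₁ ∧ f₂ ⊆ m₂ ∧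
      P.OppositeMaximal n m₁ m₂

/-- An EKR-set of flags of type `J`: no two of its flags are opposite. -/
def IsEKR (P : PolarForm F V) (n : ℕ) (J : Set ℕ) (C : Set (Set (Submodule F V))) : Prop :=
  (∀ f ∈ C, P.IsFlag J f) ∧ ∀ f₁ ∈ C, ∀ f₂ ∈ C, ¬ P.Opposite n J f₁ f₂

/-- The number of all flags of type `J`. -/
noncomputable def numFlags (P : PolarForm F V) (J : Set ℕ) : ℕ :=
  {f | P.IsFlag J f}.ncard

open Classical in
/-- The upper bound for EKR-sets of flags of type `J` in a polar space of rank `n` with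
parameter `e`, where `q` is the order of the field. -/
noncomputable def ekrBound (P : PolarForm F V) (n : ℕ) (e : ℝ) (J : Set ℕ) : ℝ :=
  if Odd n ∧ n ∈ J ∧ e = 1 / 2 then
    (P.numFlags J : ℝ) / (1 + (Nat.card F : ℝ) ^ ((n : ℝ) / 2))
  else if Odd n ∧ n ∈ J ∧ e = 0 then (P.numFlags J : ℝ) / 2
  else (P.numFlags J : ℝ) / (1 + (Nat.card F : ℝ) ^ ((n : ℝ) + e - 1))

/-- A class of generators of a hyperbolic quadric of rank `n`: the generators `N` with
`dim (N ∩ N₀) ≡ n (mod 2)`, for some generator `N₀`. -/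
def IsGeneratorClass (P : PolarForm F V) (n : ℕ) (K : Set (Submodule F V)) : Prop :=
  ∃ N₀, P.IsSubspaceOfType n N₀ ∧
    K = {N | P.IsSubspaceOfType n N ∧
      Module.finrank F ↥(N ⊓ N₀) ≡ n [MOD 2]}

/-- All flags of type `J` whose point lies in the subspace `G`. -/
def flagsPointIn (P : PolarForm F V) (J : Set ℕ) (G : Submodule F V) :
    Set (Set (Submodule F V)) :=
  {f | P.IsFlag J f ∧ ∃ p ∈ f, Module.finrank F p = 1 ∧ p ≤ G}

/-- All flags of type `J` whose generator passes through the point `p`. -/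
def flagsGeneratorThrough (P : PolarForm F V) (n : ℕ) (J : Set ℕ) (p : Submodule F V) :
    Set (Set (Submodule F V)) :=
  {f | P.IsFlag J f ∧ ∃ N ∈ f, Module.finrank F N = n ∧ p ≤ N}

/-- All flags of type `J` whose generator belongs to `K`. -/
def flagsGeneratorIn (P : PolarForm F V) (n : ℕ) (J : Set ℕ) (K : Set (Submodule F V)) :
    Set (Set (Submodule F V)) :=
  {f | P.IsFlag J f ∧ ∃ N ∈ f, Module.finrank F N = n ∧ N ∈ K}

end PolarForm

/-!
A nonzero singular vector can be mapped to any other by reflections, so the number of flags of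
type `J` whose member of dimension `k ∈ J` contains a given nonzero singular vector is a
constant `c`. Double counting incident pairs gives `v_J * (q ^ k - 1) = s * c`, where `s` is the
number of nonzero singular vectors, and the same count restricted to a generator or to a point
yields the sizes in (i) and (ii) once `s = (q ^ n - 1) * (1 + q ^ (n + e - 1))`. For the latter let
`G` be a generator: a singular vector outside `G` is not orthogonal to `G`, and for every vector `v`
not orthogonal to `G` the coset `v + G` contains the same number of singular vectors.

For (iii), let `N₁`, `N₂`, `N₃` be generators of a hyperbolic quadric. The form
`((a, b), (c, d)) ↦ B a d` on the pairs in `N₁ × N₂` whose sum lies in `N₃` is alternating, hence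
of even rank, and computing its domain and kernel shows that
`n + dim (N₁ ∩ N₂) + dim (N₁ ∩ N₃) + dim (N₂ ∩ N₃)` is even. A reflection maps every generator to
one that meets it in a hyperplane, so it exchanges the two classes. If `n` is odd, two generators of
one class have an intersection of odd dimension, whereas members of opposite flags are disjoint.
-/

section LinearAlgebra

open Module

theorem finrank_eq_of_semilinearEquiv {R S M N : Type*} [Semiring R] [Semiring S]
    [AddCommMonoid M] [Module R M] [AddCommMonoid N] [Module S N] {σ : R →+* S} {τ : S →+* R}
    [RingHomInvPair σ τ] [RingHomInvPair τ σ] (f : M ≃ₛₗ[σ] N) : finrank R M = finrank S N := by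
  have hσ : Function.Bijective σ := Function.bijective_iff_has_inverse.2
    ⟨τ, fun _ => RingHomInvPair.comp_apply_eq, fun _ => RingHomInvPair.comp_apply_eq₂⟩
  have h := lift_rank_eq_of_equiv_equiv σ f.toAddEquiv hσ (fun c v => map_smulₛₗ f c v)
  simpa only [finrank, Cardinal.toNat_lift] using congrArg Cardinal.toNat h

theorem finrank_add_finrank_orthogonalBilin {K V W : Type*} [Field K] [AddCommGroup V]
    [Module K V] [AddCommGroup W] [Module K W] [FiniteDimensional K W] {σ τ : K →+* K}
    [RingHomInvPair σ τ] [RingHomInvPair τ σ] (B : V →ₛₗ[σ] W →ₗ[K] K) {U : Submodule K V}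
    (hU : Disjoint U (LinearMap.ker B)) :
    finrank K U + finrank K (U.orthogonalBilin B) = finrank K W := by
  let f := LinearEquiv.ofInjective (B.domRestrict U) (LinearMap.injective_domRestrict_iff.2 hU)
  have hf : U.orthogonalBilin B = (LinearMap.range (B.domRestrict U)).dualCoannihilator := by
    ext y
    simp [Submodule.mem_dualCoannihilator]
  rw [finrank_eq_of_semilinearEquiv f, hf, Subspace.finrank_add_finrank_dualCoannihilator_eq]

theorem eq_span_singleton_of_finrank_eq_one {K V : Type*} [Field K] [AddCommGroup V] [Module K V]
    {U : Submodule K V} (hU : finrank K U = 1) {x : V} (hx : x ∈ U) (hx0 : x ≠ 0) :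
    U = K ∙ x :=
  have := Module.finite_of_finrank_eq_succ hU
  (Submodule.eq_of_le_of_finrank_eq ((Submodule.span_singleton_le_iff_mem _ _).2 hx)
    ((finrank_span_singleton hx0).trans hU.symm)).symm

end LinearAlgebra

section Counting

theorem ncard_mul_eq_ncard_mul {α β R : Type*} [Semiring R] {s : Set α} {t : Set β}
    (hs : s.Finite) (ht : t.Finite) (r : α → β → Prop) {m n : R}
    (hm : ∀ a ∈ s, ({b ∈ t | r a b}.ncard : R) = m)
    (hn : ∀ b ∈ t, ({a ∈ s | r a b}.ncard : R) = n) : s.ncard * m = t.ncard * n := by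
  classical
  lift s to Finset α using hs
  lift t to Finset β using ht
  have hcount := congrArg (Nat.cast : ℕ → R)
    (Finset.sum_card_bipartiteAbove_eq_sum_card_bipartiteBelow (s := s) (t := t) r)
  simp only [Nat.cast_sum, ← Set.ncard_coe_finset, Finset.coe_bipartiteAbove,
    Finset.coe_bipartiteBelow] at hcount
  simpa only [Finset.sum_const, nsmul_eq_mul, Set.ncard_coe_finset] using
    (Finset.sum_congr rfl hm).symm.trans (hcount.trans (Finset.sum_congr rfl hn))

theorem ncard_coe_submodule {R F V : Type*} [Semiring R] [Field F] [AddCommGroup V] [Module F V]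
    [FiniteDimensional F V] (U : Submodule F V) :
    ((U : Set V).ncard : R) = (Nat.card F : R) ^ Module.finrank F U := by
  rw [← Nat.card_coe_set_eq, SetLike.coe_sort_coe, Module.natCard_eq_pow_finrank (K := F),
    Nat.cast_pow]

theorem ncard_coe_submodule_sdiff_zero {R F V : Type*} [Ring R] [Field F] [Finite F]
    [AddCommGroup V] [Module F V] [FiniteDimensional F V] (U : Submodule F V) :
    (((U : Set V) \ {0}).ncard : R) = (Nat.card F : R) ^ Module.finrank F U - 1 := by
  have : Finite V := Module.finite_of_finite F
  rw [← ncard_coe_submodule, ← Set.ncard_sdiff_singleton_add_one (s := (U : Set V)) U.zero_mem,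
    Nat.cast_add, Nat.cast_one, add_sub_cancel_right]

theorem ncard_fiber_mul_natCard_range {A B : Type*} [AddGroup A] [AddGroup B] (f : A →+ B) {b : B}
    (hb : b ∈ f.range) : {a | f a = b}.ncard * Nat.card f.range = Nat.card A := by
  obtain ⟨a, rfl⟩ := hb
  rw [← AddSubgroup.card_mul_index f.ker, AddSubgroup.index_ker,
    ← Nat.card_congr (f.fiberEquivKer a)]
  rfl

end Counting

section Involution

variable {F : Type*} [Field F] {σ : F →+* F}

theorem exists_add_map_ne_zero (hσ : σ ≠ RingHom.id F) : ∃ s, s + σ s ≠ 0 := by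
  by_contra! h
  refine hσ (RingHom.ext fun a => ?_)
  have h1 := h 1
  rw [map_one] at h1
  rw [RingHom.id_apply]
  linear_combination h a - a * h1

theorem mem_range_id_add_iff (invol : ∀ a, σ (σ a) = a) (hσ : σ ≠ RingHom.id F) {a : F} :
    a ∈ (AddMonoidHom.id F + (σ : F →+ F)).range ↔ σ a = a := by
  refine ⟨?_, fun ha => ?_⟩
  · rintro ⟨s, rfl⟩
    simp [invol, add_comm]
  · obtain ⟨s, hs⟩ := exists_add_map_ne_zero hσ
    have hfix : σ (s + σ s) = s + σ s := by rw [map_add, invol, add_comm]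
    refine ⟨a * s / (s + σ s), ?_⟩
    simp only [AddMonoidHom.add_apply, AddMonoidHom.id_apply, AddMonoidHom.coe_coe, map_div₀,
      map_mul, ha, hfix]
    field_simp

theorem natCard_ker_id_add_eq (invol : ∀ a, σ (σ a) = a) (hσ : σ ≠ RingHom.id F) :
    Nat.card (AddMonoidHom.id F + (σ : F →+ F)).ker =
      Nat.card (AddMonoidHom.id F + (σ : F →+ F)).range := by
  obtain ⟨b, hb⟩ : ∃ b, b - σ b ≠ 0 := by
    by_contra! h
    exact hσ (RingHom.ext fun a => (sub_eq_zero.1 (h a)).symm)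
  have hanti : σ (b - σ b) = -(b - σ b) := by rw [map_sub, invol, neg_sub]
  refine Nat.card_congr ((Equiv.divRight₀ (b - σ b) hb).subtypeEquiv fun a => ?_)
  rw [mem_range_id_add_iff invol hσ, AddMonoidHom.mem_ker, Equiv.divRight₀_apply, map_div₀, hanti,
    div_neg, neg_eq_iff_add_eq_zero, ← add_div, div_eq_zero_iff, or_iff_left hb, add_comm]
  rfl

theorem natCard_range_id_add_sq (invol : ∀ a, σ (σ a) = a) (hσ : σ ≠ RingHom.id F) :
    Nat.card (AddMonoidHom.id F + (σ : F →+ F)).range ^ 2 = Nat.card F := by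
  rw [← AddSubgroup.card_mul_index (AddMonoidHom.id F + (σ : F →+ F)).ker, AddSubgroup.index_ker,
    natCard_ker_id_add_eq invol hσ, sq]

end Involution

namespace PolarForm

variable {F V : Type*} [Field F] [AddCommGroup V] [Module F V]

/-- The field automorphism with respect to which the form is semilinear in its first argument. -/
def conj : PolarForm F V → (F →+* F)
  | symplectic _ _ _ => RingHom.id F
  | hermitian σ _ _ _ _ _ => σ
  | quadratic _ _ => RingHom.id F

theorem conj_conj (P : PolarForm F V) (a : F) : P.conj (P.conj a) = a := by
  cases P with
  | symplectic => rfl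
  | hermitian σ invol => exact invol a
  | quadratic => rfl

instance (P : PolarForm F V) : RingHomInvPair P.conj P.conj where
  comp_eq := RingHom.ext P.conj_conj
  comp_eq₂ := RingHom.ext P.conj_conj

/-- The reflexive sesquilinear form underlying a polar form: in the quadratic case, the polar form
of the quadratic form. -/
def form : (P : PolarForm F V) → V →ₛₗ[P.conj] V →ₗ[F] F
  | symplectic B _ _ => B
  | hermitian _ _ _ H _ _ => H
  | quadratic Q _ => QuadraticMap.polarBilin Q

/-- The factor by which the form changes, up to conjugation, when its arguments are exchanged. -/
def sign : PolarForm F V → F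
  | symplectic _ _ _ => -1
  | hermitian _ _ _ _ _ _ => 1
  | quadratic _ _ => 1

theorem conj_form (P : PolarForm F V) (x y : V) :
    P.conj (P.form x y) = P.sign * P.form y x := by
  cases P with
  | symplectic B alt =>
    have hB : B.IsAlt := alt
    change B x y = -1 * B y x
    rw [← hB.neg, neg_one_mul]
  | hermitian σ invol nontriv H symm => exact (symm x y).trans (one_mul _).symm
  | quadratic Q => exact (QuadraticMap.polar_comm Q x y).trans (one_mul _).symm

theorem perp_iff (P : PolarForm F V) (x y : V) : P.Perp x y ↔ P.form x y = 0 := by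
  cases P <;> rfl

theorem form_isRefl (P : PolarForm F V) : P.form.IsRefl := fun x y h =>
  (map_eq_zero P.conj).1 (by rw [conj_form, h, mul_zero])

theorem sign_ne_zero (P : PolarForm F V) : P.sign ≠ 0 := by
  cases P <;> simp [sign]

/-- The value of the form on a vector, which vanishes exactly when the vector is singular. -/
def value : PolarForm F V → V → F
  | symplectic B _ _, x => B x x
  | hermitian _ _ _ H _ _, x => H x x
  | quadratic Q _, x => Q x

/-- The additive map `T` with `value (x + y) = value x + value y + T (form x y)`; its range is the
additive group in which the form takes its values. -/
def trace : PolarForm F V → F →+ F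
  | symplectic _ _ _ => 0
  | hermitian σ _ _ _ _ _ => AddMonoidHom.id F + (σ : F →+ F)
  | quadratic _ _ => AddMonoidHom.id F

theorem singular_iff_value_eq_zero (P : PolarForm F V) (x : V) : P.Singular x ↔ P.value x = 0 := by
  cases P <;> rfl

theorem value_add (P : PolarForm F V) (x y : V) :
    P.value (x + y) = P.value x + P.value y + P.trace (P.form x y) := by
  cases P with
  | symplectic B alt =>
    change B (x + y) (x + y) = B x x + B y y + 0
    rw [alt, alt, alt, add_zero, add_zero]
  | hermitian σ invol nontriv H symm =>
    change H (x + y) (x + y) = H x x + H y y + (H x y + σ (H x y))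
    rw [symm, map_add, map_add, LinearMap.add_apply, LinearMap.add_apply]
    ring
  | quadratic Q => exact QuadraticMap.map_add Q x y

theorem value_mem_range_trace (P : PolarForm F V) (x : V) : P.value x ∈ P.trace.range := by
  cases P with
  | symplectic _ alt => exact ⟨0, (alt x).symm⟩
  | hermitian σ invol nontriv H symm =>
    exact (mem_range_id_add_iff invol nontriv).2 (symm x x)
  | quadratic Q => exact ⟨Q x, rfl⟩

theorem Singular.form_self_eq_zero {P : PolarForm F V} {x : V} (hx : P.Singular x) :
    P.form x x = 0 := by
  cases P with
  | symplectic => exact hx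
  | hermitian => exact hx
  | quadratic Q =>
    have hx : Q x = 0 := hx
    change QuadraticMap.polar Q x x = 0
    simp [hx]

theorem Singular.eq_zero_of_form {P : PolarForm F V} {x : V} (hx : P.Singular x)
    (h : ∀ y, P.form x y = 0) : x = 0 := by
  cases P with
  | symplectic _ _ nondeg => exact nondeg x h
  | hermitian _ _ _ _ _ nondeg => exact nondeg x h
  | quadratic _ nondeg => exact nondeg x hx h

theorem Singular.value_add {P : PolarForm F V} {y : V} (hy : P.Singular y) (x : V) :
    P.value (x + y) = P.value x + P.trace (P.form x y) := by
  rw [PolarForm.value_add, (P.singular_iff_value_eq_zero y).1 hy, add_zero]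

theorem Singular.add {P : PolarForm F V} {x y : V} (hx : P.Singular x) (hy : P.Singular y)
    (h : P.form x y = 0) : P.Singular (x + y) := by
  rw [singular_iff_value_eq_zero] at hx ⊢
  rw [hy.value_add, hx, h, map_zero, add_zero]

theorem Singular.smul {P : PolarForm F V} {x : V} (hx : P.Singular x) (c : F) :
    P.Singular (c • x) := by
  cases P with
  | symplectic _ alt => exact alt _
  | hermitian _ _ _ H =>
    have hx : H x x = 0 := hx
    simp [Singular, hx]
  | quadratic Q =>
    have hx : Q x = 0 := hx
    simp [Singular, QuadraticMap.map_smul, hx]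

namespace TotallySingular

variable {P : PolarForm F V} {U W : Submodule F V}

theorem form_eq_zero (hU : P.TotallySingular U) {x y : V} (hx : x ∈ U) (hy : y ∈ U) :
    P.form x y = 0 :=
  (P.perp_iff x y).1 (hU.2 x hx y hy)

theorem le_orthogonalBilin (hU : P.TotallySingular U) : U ≤ U.orthogonalBilin P.form :=
  fun _ hy _ hx => hU.form_eq_zero hx hy

theorem span_singleton {x : V} (hx : P.Singular x) : P.TotallySingular (F ∙ x) := by
  refine ⟨fun y hy => ?_, fun y hy z hz => (P.perp_iff y z).2 ?_⟩
  · obtain ⟨c, rfl⟩ := Submodule.mem_span_singleton.1 hy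
    exact hx.smul c
  · obtain ⟨c, rfl⟩ := Submodule.mem_span_singleton.1 hy
    obtain ⟨d, rfl⟩ := Submodule.mem_span_singleton.1 hz
    simp [hx.form_self_eq_zero]

theorem sup (hU : P.TotallySingular U) (hW : P.TotallySingular W)
    (h : W ≤ U.orthogonalBilin P.form) : P.TotallySingular (U ⊔ W) := by
  refine ⟨fun x hx => ?_, fun x hx y hy => (P.perp_iff x y).2 ?_⟩
  · obtain ⟨u, hu, w, hw, rfl⟩ := Submodule.mem_sup.1 hx
    exact (hU.1 u hu).add (hW.1 w hw) (h hw u hu)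
  · obtain ⟨u, hu, w, hw, rfl⟩ := Submodule.mem_sup.1 hx
    obtain ⟨u', hu', w', hw', rfl⟩ := Submodule.mem_sup.1 hy
    simp [hU.form_eq_zero hu hu', hW.form_eq_zero hw hw', h hw' u hu,
      P.form_isRefl _ _ (h hw u' hu')]

theorem disjoint_ker_form (hU : P.TotallySingular U) : Disjoint U (LinearMap.ker P.form) :=
  Submodule.disjoint_def.2 fun x hx hker =>
    (hU.1 x hx).eq_zero_of_form fun y => by rw [LinearMap.mem_ker.1 hker, LinearMap.zero_apply]

theorem finrank_add_finrank_orthogonalBilin [FiniteDimensional F V] (hU : P.TotallySingular U) :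
    Module.finrank F U + Module.finrank F (U.orthogonalBilin P.form) = Module.finrank F V :=
  _root_.finrank_add_finrank_orthogonalBilin P.form hU.disjoint_ker_form

end TotallySingular

theorem IsSubspaceOfType.mem_of_singular_of_mem_orthogonalBilin [FiniteDimensional F V]
    {P : PolarForm F V} {n : ℕ} {G : Submodule F V} (hP : P.HasRank n)
    (hG : P.IsSubspaceOfType n G) {x : V} (hx : P.Singular x) (hxG : x ∈ G.orthogonalBilin P.form) :
    x ∈ G := by
  have hsup : P.TotallySingular (G ⊔ F ∙ x) :=
    hG.1.sup (.span_singleton hx) ((Submodule.span_singleton_le_iff_mem _ _).2 hxG)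
  have hle : G ⊔ F ∙ x ≤ G :=
    (Submodule.eq_of_le_of_finrank_le le_sup_left (by rw [hG.2]; exact hP.2 _ hsup)).ge
  exact hle (Submodule.mem_sup_right (Submodule.mem_span_singleton_self x))

theorem exists_singular_form_ne_zero (P : PolarForm F V) {x : V} (hx : P.Singular x)
    (hx0 : x ≠ 0) : ∃ y, P.Singular y ∧ P.form x y ≠ 0 := by
  obtain ⟨w, hxw⟩ : ∃ w, P.form x w ≠ 0 := by
    by_contra! h
    exact hx0 (hx.eq_zero_of_form h)
  have hwx : P.form w x ≠ 0 := mt (P.form_isRefl w x) hxw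
  obtain ⟨s, hs⟩ := neg_mem (P.value_mem_range_trace w)
  refine ⟨w + (s / P.form w x) • x, ?_, ?_⟩
  · rw [singular_iff_value_eq_zero, (hx.smul _).value_add, map_smul, smul_eq_mul,
      div_mul_cancel₀ _ hwx, hs, add_neg_cancel]
  · rwa [map_add, map_smul, hx.form_self_eq_zero, smul_zero, add_zero]

section Isometry

variable {P : PolarForm F V} {x y : V}

theorem Singular.form_sub_sub (hx : P.Singular x) (hy : P.Singular y) :
    P.form (x - y) (x - y) = -(P.form x y + P.form y x) := by
  simp only [map_sub, LinearMap.sub_apply, hx.form_self_eq_zero, hy.form_self_eq_zero]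
  ring

theorem Singular.form_add_smul_sub (hx : P.Singular x) (hy : P.Singular y) (h : P.form x y ≠ 0)
    (v w : V) :
    P.form (v + ((P.form y x)⁻¹ * P.form (x - y) v) • (x - y))
      (w + ((P.form y x)⁻¹ * P.form (x - y) w) • (x - y)) = P.form v w := by
  have hyx : P.form y x ≠ 0 := mt (P.form_isRefl y x) h
  have hself := hx.form_sub_sub hy
  have hconj : P.conj (P.form y x)⁻¹ = (P.sign * P.form x y)⁻¹ := by rw [map_inv₀, conj_form]
  have hsign := P.sign_ne_zero
  generalize x - y = u at hself ⊢
  simp only [map_add, map_smul, LinearMap.add_apply, map_smulₛₗ, LinearMap.smul_apply, smul_eq_mul,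
    map_mul, conj_form, hself, hconj]
  field_simp
  ring

theorem quadraticForm_add_smul_sub {Q : QuadraticForm F V} (hx : Q x = 0) (hy : Q y = 0)
    (h : QuadraticMap.polar Q y x ≠ 0) (v : V) :
    Q (v + ((QuadraticMap.polar Q y x)⁻¹ * QuadraticMap.polar Q (x - y) v) • (x - y)) = Q v := by
  have hu : Q (x - y) = -QuadraticMap.polar Q y x := by
    have hQ := QuadraticMap.map_add Q x (-y)
    rw [QuadraticMap.polar_neg_right, QuadraticMap.map_neg, hx, hy, ← sub_eq_add_neg,
      QuadraticMap.polar_comm] at hQ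
    simpa using hQ
  rw [QuadraticMap.map_add Q, QuadraticMap.polar_smul_right, QuadraticMap.map_smul, hu,
    QuadraticMap.polar_comm Q v]
  simp only [smul_eq_mul]
  field_simp
  ring

theorem Singular.exists_isometry_of_form_ne_zero (hx : P.Singular x) (hy : P.Singular y)
    (h : P.form x y ≠ 0) :
    ∃ g : V ≃ₗ[F] V, P.IsIsometry g ∧ g x = y ∧ ∀ v, P.form (x - y) v = 0 → g v = v := by
  have hyx : P.form y x ≠ 0 := mt (P.form_isRefl y x) h
  have hunit : IsUnit (1 + ((P.form y x)⁻¹ • P.form (x - y)) (x - y)) := by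
    rw [LinearMap.smul_apply, hx.form_sub_sub hy, isUnit_iff_ne_zero, smul_eq_mul,
      show 1 + (P.form y x)⁻¹ * -(P.form x y + P.form y x) = -(P.form x y / P.form y x) by
        field_simp; ring]
    exact neg_ne_zero.2 (div_ne_zero h hyx)
  have hg (v : V) : LinearEquiv.dilatransvection hunit v =
      v + ((P.form y x)⁻¹ * P.form (x - y) v) • (x - y) := LinearEquiv.dilatransvection.apply
  refine ⟨LinearEquiv.dilatransvection hunit, ?_, ?_, fun v hv => ?_⟩
  · cases P with
    | symplectic =>
      intro v w
      rw [hg, hg]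
      exact hx.form_add_smul_sub hy h v w
    | hermitian =>
      intro v w
      rw [hg, hg]
      exact hx.form_add_smul_sub hy h v w
    | quadratic Q =>
      intro v
      rw [hg]
      exact quadraticForm_add_smul_sub hx hy hyx v
  · rw [hg, map_sub, LinearMap.sub_apply, hx.form_self_eq_zero, zero_sub, mul_neg,
      inv_mul_cancel₀ hyx, neg_one_smul, neg_sub, add_sub_cancel]
  · rw [hg, hv, mul_zero, zero_smul, add_zero]

namespace IsIsometry

variable {g h : V ≃ₗ[F] V}

theorem singular_iff (hg : P.IsIsometry g) (x : V) : P.Singular (g x) ↔ P.Singular x := by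
  cases P <;> exact iff_of_eq (congrArg (· = 0) (hg ..))

theorem form_eq (hg : P.IsIsometry g) (x y : V) : P.form (g x) (g y) = P.form x y := by
  cases P with
  | symplectic => exact hg x y
  | hermitian => exact hg x y
  | quadratic Q =>
    have hg : ∀ x, Q (g x) = Q x := hg
    change QuadraticMap.polar Q (g x) (g y) = QuadraticMap.polar Q x y
    simp only [QuadraticMap.polar, ← map_add, hg]

theorem trans (hg : P.IsIsometry g) (hh : P.IsIsometry h) : P.IsIsometry (g.trans h) := by
  cases P with
  | symplectic => exact fun x y => (hh _ _).trans (hg x y)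
  | hermitian => exact fun x y => (hh _ _).trans (hg x y)
  | quadratic => exact fun x => (hh _).trans (hg x)

theorem totallySingular_map (hg : P.IsIsometry g) {U : Submodule F V} (hU : P.TotallySingular U) :
    P.TotallySingular (U.map (g : V →ₗ[F] V)) := by
  refine ⟨?_, ?_⟩
  · rintro _ ⟨x, hx, rfl⟩
    exact (hg.singular_iff x).2 (hU.1 x hx)
  · rintro _ ⟨x, hx, rfl⟩ _ ⟨y, hy, rfl⟩
    exact (P.perp_iff _ _).2 ((hg.form_eq x y).trans (hU.form_eq_zero hx hy))

end IsIsometry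

/-- Two vectors are in the same orbit of the isometry group. -/
def SameOrbit (P : PolarForm F V) (x y : V) : Prop :=
  ∃ g : V ≃ₗ[F] V, P.IsIsometry g ∧ g x = y

theorem SameOrbit.trans {z : V} (hxy : P.SameOrbit x y) (hyz : P.SameOrbit y z) :
    P.SameOrbit x z := by
  obtain ⟨g, hg, rfl⟩ := hxy
  obtain ⟨h, hh, rfl⟩ := hyz
  exact ⟨g.trans h, hg.trans hh, rfl⟩

theorem Singular.sameOrbit_of_form_ne_zero (hx : P.Singular x) (hy : P.Singular y)
    (h : P.form x y ≠ 0) : P.SameOrbit x y :=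
  have ⟨g, hg, hgx, _⟩ := hx.exists_isometry_of_form_ne_zero hy h
  ⟨g, hg, hgx⟩

theorem Singular.sameOrbit (hx : P.Singular x) (hy : P.Singular y) (hx0 : x ≠ 0) (hy0 : y ≠ 0) :
    P.SameOrbit x y := by
  -- A path from `x` to `y` through `z`, `w` or `z + w` has no orthogonal consecutive vectors.
  obtain ⟨z, hz, hxz⟩ := P.exists_singular_form_ne_zero hx hx0
  obtain ⟨w, hw, hyw⟩ := P.exists_singular_form_ne_zero hy hy0
  have hwy : P.form w y ≠ 0 := mt (P.form_isRefl w y) hyw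
  have to_z := hx.sameOrbit_of_form_ne_zero hz hxz
  have from_w := hw.sameOrbit_of_form_ne_zero hy hwy
  by_cases hzy : P.form z y = 0
  · by_cases hxw : P.form x w = 0
    · by_cases hzw : P.form z w = 0
      · have hsum := hz.add hw hzw
        exact (hx.sameOrbit_of_form_ne_zero hsum (by rwa [map_add, hxw, add_zero])).trans
          (hsum.sameOrbit_of_form_ne_zero hy
            (by rwa [map_add, LinearMap.add_apply, hzy, zero_add]))
      · exact to_z.trans ((hz.sameOrbit_of_form_ne_zero hw hzw).trans from_w)
    · exact (hx.sameOrbit_of_form_ne_zero hw hxw).trans from_w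
  · exact to_z.trans (hz.sameOrbit_of_form_ne_zero hy hzy)

end Isometry

section Counting

variable {P : PolarForm F V}

theorem TotallySingular.ncard_coset_mul_card_range_trace {G : Submodule F V}
    (hG : P.TotallySingular G) {v : V} (hv : v ∉ G.orthogonalBilin P.form) :
    {g ∈ (G : Set V) | P.Singular (v + g)}.ncard * Nat.card P.trace.range = Nat.card G := by
  let φ : G →ₗ[F] F := P.form v ∘ₗ G.subtype
  have hφ : Function.Surjective φ := by
    refine LinearMap.surjective fun h0 => hv fun g hg => ?_
    exact P.form_isRefl v g (LinearMap.congr_fun h0 ⟨g, hg⟩)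
  have hrange : (P.trace.comp φ.toAddMonoidHom).range = P.trace.range := by
    rw [AddMonoidHom.range_comp, AddMonoidHom.range_eq_top.2 hφ, AddMonoidHom.range_eq_map]
  have hset : {g ∈ (G : Set V) | P.Singular (v + g)} =
      (↑) '' {g : G | P.trace.comp φ.toAddMonoidHom g = -P.value v} := by
    ext g
    simp only [Set.mem_ofPred_eq, Set.mem_image, Subtype.exists, exists_and_right, exists_eq_right,
      SetLike.mem_coe]
    refine (exists_prop (a := g ∈ G)).symm.trans (exists_congr fun hg => ?_)
    rw [singular_iff_value_eq_zero, (hG.1 g hg).value_add, add_comm, add_eq_zero_iff_eq_neg]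
    rfl
  rw [hset, Set.ncard_image_of_injective _ Subtype.val_injective, ← hrange]
  exact ncard_fiber_mul_natCard_range _ (hrange ▸ neg_mem (P.value_mem_range_trace v))

theorem TotallySingular.ncard_compl_orthogonalBilin [Finite F] [FiniteDimensional F V]
    {G : Submodule F V} (hG : P.TotallySingular G) :
    ((G.orthogonalBilin P.form : Set V)ᶜ).ncard =
      Nat.card P.trace.range * {s | P.Singular s ∧ s ∉ G.orthogonalBilin P.form}.ncard := by
  have : Finite V := Module.finite_of_finite F
  have hrange : (Nat.card P.trace.range : ℝ) ≠ 0 := Nat.cast_ne_zero.2 Nat.card_pos.ne'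
  have hcardG : (Nat.card G : ℝ) ≠ 0 := Nat.cast_ne_zero.2 Nat.card_pos.ne'
  have hcoset : ∀ v ∈ (G.orthogonalBilin P.form : Set V)ᶜ,
      ({g ∈ (G : Set V) | P.Singular (v + g)}.ncard : ℝ) =
        Nat.card G / Nat.card P.trace.range := by
    intro v hv
    rw [eq_div_iff hrange]
    exact_mod_cast hG.ncard_coset_mul_card_range_trace hv
  have htranslate : ∀ g ∈ (G : Set V),
      ({v ∈ (G.orthogonalBilin P.form : Set V)ᶜ | P.Singular (v + g)}.ncard : ℝ) =
        {s | P.Singular s ∧ s ∉ G.orthogonalBilin P.form}.ncard := by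
    intro g hg
    refine congrArg Nat.cast (Eq.trans ?_ (Set.ncard_preimage_of_injective_subset_range
      (add_left_injective g) fun s _ => ⟨s - g, sub_add_cancel s g⟩))
    congr 1
    ext v
    exact and_comm.trans (and_congr_right fun _ => not_congr
      (Submodule.add_mem_iff_left _ (hG.le_orthogonalBilin hg)).symm)
  have hcount := ncard_mul_eq_ncard_mul (Set.toFinite _) (Set.toFinite _)
    (fun v g => P.Singular (v + g)) hcoset htranslate
  rw [← Nat.card_coe_set_eq (G : Set V), SetLike.coe_sort_coe] at hcount
  field_simp at hcount
  exact_mod_cast hcount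

theorem HasParameter.natCard_pow_finrank [Finite F] {n : ℕ} {e : ℝ} (h : P.HasParameter n e) :
    (Nat.card F : ℝ) ^ Module.finrank F V =
      Nat.card P.trace.range * (Nat.card F : ℝ) ^ n * (Nat.card F : ℝ) ^ ((n : ℝ) + e - 1) := by
  have hq : (0 : ℝ) < Nat.card F := Nat.cast_pos.2 Nat.card_pos
  obtain ⟨a, ha, hdim⟩ : ∃ a : ℝ, (Nat.card P.trace.range : ℝ) = (Nat.card F : ℝ) ^ a ∧
      (Module.finrank F V : ℝ) = a + n + (n + e - 1) := by
    cases P with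
    | symplectic =>
      obtain ⟨hV, rfl⟩ := h
      refine ⟨0, ?_, by rw [hV]; push_cast; ring⟩
      simp [trace]
    | hermitian σ invol nontriv =>
      refine ⟨1 / 2, ?_, ?_⟩
      · rw [← natCard_range_id_add_sq invol nontriv, Nat.cast_pow, ← Real.sqrt_eq_rpow,
          Real.sqrt_sq (Nat.cast_nonneg _)]
        rfl
      · obtain ⟨hV, rfl⟩ | ⟨hV, rfl⟩ := h <;> rw [hV] <;> push_cast <;> ring
    | quadratic =>
      refine ⟨1, ?_, ?_⟩
      · simp [trace]
      · obtain ⟨hV, rfl⟩ | ⟨hV, rfl⟩ | ⟨hV, rfl⟩ := h <;> rw [hV] <;> push_cast <;> ring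
  rw [ha, ← Real.rpow_natCast, ← Real.rpow_natCast, ← Real.rpow_add hq, ← Real.rpow_add hq, hdim]

/-- The nonzero singular vectors, that is, the vectors that span the points of the polar space. -/
def singularVectors (P : PolarForm F V) : Set V :=
  {x | P.Singular x ∧ x ≠ 0}

theorem IsSubspaceOfType.ncard_singularVectors_add_one [Finite F] [FiniteDimensional F V] {n : ℕ}
    {G : Submodule F V} (hP : P.HasRank n) (hG : P.IsSubspaceOfType n G) :
    P.singularVectors.ncard + 1 =
      {s | P.Singular s ∧ s ∉ G.orthogonalBilin P.form}.ncard + (G : Set V).ncard := by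
  have : Finite V := Module.finite_of_finite F
  rw [← Set.ncard_insert_of_notMem (a := (0 : V)) fun h => h.2 rfl, ← Set.ncard_union_eq
    (Set.disjoint_left.2 fun s hs hsG => hs.2 (hG.1.le_orthogonalBilin hsG))]
  congr 1
  ext s
  have hsG : P.Singular s → s ∈ G.orthogonalBilin P.form → s ∈ G :=
    hG.mem_of_singular_of_mem_orthogonalBilin hP
  have hGs : s ∈ G → P.Singular s := hG.1.1 s
  have h0 : (0 : V) ∈ G := G.zero_mem
  simp only [singularVectors, Set.mem_insert_iff, Set.mem_union, Set.mem_ofPred_eq,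
    SetLike.mem_coe]
  grind

theorem ncard_singularVectors [Finite F] [FiniteDimensional F V] {n : ℕ} {e : ℝ}
    (hP : P.IsPolarSpace n e) : (P.singularVectors.ncard : ℝ) =
      ((Nat.card F : ℝ) ^ n - 1) * (1 + (Nat.card F : ℝ) ^ ((n : ℝ) + e - 1)) := by
  have : Finite V := Module.finite_of_finite F
  obtain ⟨G, hG⟩ := hP.1.1
  have hpow := hP.2.natCard_pow_finrank
  have horth : (Nat.card F : ℝ) ^ Module.finrank F (G.orthogonalBilin P.form) =
      Nat.card P.trace.range * (Nat.card F : ℝ) ^ ((n : ℝ) + e - 1) := by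
    have hq : (Nat.card F : ℝ) ≠ 0 := Nat.cast_ne_zero.2 Nat.card_pos.ne'
    rw [← hG.1.finrank_add_finrank_orthogonalBilin, pow_add, hG.2] at hpow
    exact mul_left_cancel₀ (pow_ne_zero n hq) (by linear_combination hpow)
  have hoff := congrArg (Nat.cast (R := ℝ)) hG.1.ncard_compl_orthogonalBilin
  rw [Set.ncard_compl, Nat.cast_sub (Set.ncard_le_card _), Nat.cast_mul, ncard_coe_submodule,
    Module.natCard_eq_pow_finrank (K := F), Nat.cast_pow, hpow, horth] at hoff
  have hrange : (Nat.card P.trace.range : ℝ) ≠ 0 := Nat.cast_ne_zero.2 Nat.card_pos.ne'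
  have hsplit := congrArg (Nat.cast (R := ℝ)) (hG.ncard_singularVectors_add_one hP.1)
  rw [Nat.cast_add, Nat.cast_add, ncard_coe_submodule, hG.2] at hsplit
  refine mul_left_cancel₀ hrange ?_
  linear_combination Nat.card P.trace.range * hsplit - hoff

end Counting

section Flags

variable {P : PolarForm F V} {J : Set ℕ} {k : ℕ} {f : Set (Submodule F V)}

namespace IsFlag

theorem eq_of_finrank_eq [FiniteDimensional F V] (hf : P.IsFlag J f) {U W : Submodule F V}
    (hU : U ∈ f) (hW : W ∈ f) (h : Module.finrank F U = Module.finrank F W) : U = W :=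
  (hf.2.1.total hU hW).elim (Submodule.eq_of_le_of_finrank_eq · h)
    fun hle => (Submodule.eq_of_le_of_finrank_eq hle h.symm).symm

theorem exists_mem (hf : P.IsFlag J f) (hk : k ∈ J) : ∃ U ∈ f, Module.finrank F U = k :=
  hf.2.2.ge hk

theorem exists_mem_finrank_eq_iff [FiniteDimensional F V] (hf : P.IsFlag J f)
    {U : Submodule F V} (hU : U ∈ f) (hk : Module.finrank F U = k) {K : Set (Submodule F V)} :
    (∃ W ∈ f, Module.finrank F W = k ∧ W ∈ K) ↔ U ∈ K := by
  constructor
  · rintro ⟨W, hW, hWk, hWK⟩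
    rwa [hf.eq_of_finrank_eq hU hW (hk.trans hWk.symm)]
  · exact fun hUK => ⟨U, hU, hk, hUK⟩

theorem map (hf : P.IsFlag J f) {g : V ≃ₗ[F] V} (hg : P.IsIsometry g) :
    P.IsFlag J (Submodule.map (g : V →ₗ[F] V) '' f) := by
  refine ⟨?_, ?_, ?_⟩
  · rintro _ ⟨U, hU, rfl⟩
    exact hg.totallySingular_map (hf.1 U hU)
  · rintro _ ⟨U, hU, rfl⟩ _ ⟨W, hW, rfl⟩ -
    exact (hf.2.1.total hU hW).imp Submodule.map_mono Submodule.map_mono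
  · rw [Set.image_image, ← hf.2.2]
    exact Set.image_congr fun U _ => LinearEquiv.finrank_map_eq g U

end IsFlag

/-- The flags of type `J` whose member of dimension `k` contains the vector `v`. -/
def flagsThrough (P : PolarForm F V) (J : Set ℕ) (k : ℕ) (v : V) : Set (Set (Submodule F V)) :=
  {f | P.IsFlag J f ∧ ∃ U ∈ f, Module.finrank F U = k ∧ v ∈ U}

theorem SameOrbit.ncard_flagsThrough_le [Finite V] {v w : V} (h : P.SameOrbit v w) :
    (P.flagsThrough J k v).ncard ≤ (P.flagsThrough J k w).ncard := by
  obtain ⟨g, hg, rfl⟩ := h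
  refine Set.ncard_le_ncard_of_injOn (Submodule.map (g : V →ₗ[F] V) '' ·) ?_
    (Set.image_injective.2 (Submodule.map_injective_of_injective g.injective)).injOn
  rintro f ⟨hf, U, hU, rfl, hv⟩
  exact ⟨hf.map hg, _, ⟨U, hU, rfl⟩, LinearEquiv.finrank_map_eq g U, Submodule.mem_map_of_mem hv⟩

theorem exists_ncard_flagsThrough_eq [Finite V] (P : PolarForm F V) (J : Set ℕ) (k : ℕ) :
    ∃ c, ∀ v ∈ P.singularVectors, (P.flagsThrough J k v).ncard = c := by
  obtain h | ⟨v, hv⟩ := P.singularVectors.eq_empty_or_nonempty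
  · simp [h]
  · exact ⟨(P.flagsThrough J k v).ncard, fun w hw => le_antisymm
      (hw.1.sameOrbit hv.1 hw.2 hv.2).ncard_flagsThrough_le
      (hv.1.sameOrbit hw.1 hv.2 hw.2).ncard_flagsThrough_le⟩

section Finite

variable [Finite F] [FiniteDimensional F V]

/- Both sides count the pairs of a flag in `C` and a nonzero vector in its member of
dimension `k`. -/
theorem ncard_mul_pow_sub_one {C : Set (Set (Submodule F V))} {T : Set V} {c : ℕ} (hk : k ∈ J)
    (hC : ∀ f ∈ C, P.IsFlag J f ∧ ∀ U ∈ f, Module.finrank F U = k → ∀ x ∈ U, x ≠ 0 → x ∈ T)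
    (hT : T ⊆ P.singularVectors) (hTC : ∀ v ∈ T, P.flagsThrough J k v ⊆ C)
    (hc : ∀ v ∈ P.singularVectors, (P.flagsThrough J k v).ncard = c) :
    (C.ncard : ℝ) * ((Nat.card F : ℝ) ^ k - 1) = T.ncard * c := by
  have : Finite V := Module.finite_of_finite F
  refine ncard_mul_eq_ncard_mul (Set.toFinite _) (Set.toFinite _)
    (fun f v => ∃ U : Submodule F V, U ∈ f ∧ Module.finrank F U = k ∧ v ∈ U)
    (fun f hf => ?_) fun v hv => ?_
  · obtain ⟨hflag, hfT⟩ := hC f hf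
    obtain ⟨U, hU, rfl⟩ := hflag.exists_mem hk
    rw [← ncard_coe_submodule_sdiff_zero U]
    congr 2
    ext x
    constructor
    · rintro ⟨hx, W, hW, hWU, hxW⟩
      exact ⟨hflag.eq_of_finrank_eq hW hU hWU ▸ hxW, (hT hx).2⟩
    · rintro ⟨hx, hx0⟩
      exact ⟨hfT U hU rfl x hx hx0, U, hU, rfl, hx⟩
  · rw [← hc v (hT hv)]
    congr 2
    ext f
    exact ⟨fun h => ⟨(hC f h.1).1, h.2⟩, fun h => ⟨hTC v hv h, h.2⟩⟩

theorem numFlags_mul_pow_sub_one {c : ℕ} (hk : k ∈ J)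
    (hc : ∀ v ∈ P.singularVectors, (P.flagsThrough J k v).ncard = c) :
    (P.numFlags J : ℝ) * ((Nat.card F : ℝ) ^ k - 1) = P.singularVectors.ncard * c :=
  ncard_mul_pow_sub_one hk
    (fun _ hf => ⟨hf, fun U hU _ x hx hx0 => ⟨(hf.1 U hU).1 x hx, hx0⟩⟩) subset_rfl
    (fun _ _ _ h => h.1) hc

theorem ncard_flagsPointIn_mul {G : Submodule F V} (hG : P.TotallySingular G) {c : ℕ}
    (hJ : 1 ∈ J) (hc : ∀ v ∈ P.singularVectors, (P.flagsThrough J 1 v).ncard = c) :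
    ((P.flagsPointIn J G).ncard : ℝ) * (Nat.card F - 1) =
      ((Nat.card F : ℝ) ^ Module.finrank F G - 1) * c := by
  rw [← ncard_coe_submodule_sdiff_zero G, ← pow_one (Nat.card F : ℝ)]
  refine ncard_mul_pow_sub_one hJ ?_ (fun x hx => ⟨hG.1 x hx.1, hx.2⟩) ?_ hc
  · rintro f ⟨hf, p, hp, hp1, hpG⟩
    refine ⟨hf, fun U hU hU1 x hx hx0 => ⟨hpG ?_, hx0⟩⟩
    rwa [hf.eq_of_finrank_eq hp hU (hp1.trans hU1.symm)]
  · rintro v ⟨hvG, hv0⟩ f ⟨hf, U, hU, hU1, hvU⟩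
    refine ⟨hf, U, hU, hU1, ?_⟩
    rwa [eq_span_singleton_of_finrank_eq_one hU1 hvU hv0, Submodule.span_singleton_le_iff_mem]

variable {n : ℕ} {e : ℝ}

theorem ncard_flagsPointIn (hP : P.IsPolarSpace n e) (hJ : 1 ∈ J) {G : Submodule F V}
    (hG : P.IsSubspaceOfType n G) : ((P.flagsPointIn J G).ncard : ℝ) =
      P.numFlags J / (1 + (Nat.card F : ℝ) ^ ((n : ℝ) + e - 1)) := by
  have : Finite V := Module.finite_of_finite F
  obtain ⟨c, hc⟩ := P.exists_ncard_flagsThrough_eq J 1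
  have hall := numFlags_mul_pow_sub_one hJ hc
  have hpointIn := ncard_flagsPointIn_mul hG.1 hJ hc
  rw [ncard_singularVectors hP, pow_one] at hall
  rw [hG.2] at hpointIn
  have hq : (Nat.card F : ℝ) - 1 ≠ 0 := sub_ne_zero.2 (by exact_mod_cast Finite.one_lt_card.ne')
  rw [eq_div_iff (by positivity)]
  refine mul_right_cancel₀ hq ?_
  linear_combination (1 + (Nat.card F : ℝ) ^ ((n : ℝ) + e - 1)) * hpointIn - hall

theorem ncard_flagsGeneratorThrough (hP : P.IsPolarSpace n e) (hJ : n ∈ J) {p : Submodule F V}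
    (hp : P.IsSubspaceOfType 1 p) : ((P.flagsGeneratorThrough n J p).ncard : ℝ) =
      P.numFlags J / (1 + (Nat.card F : ℝ) ^ ((n : ℝ) + e - 1)) := by
  have : Finite V := Module.finite_of_finite F
  obtain ⟨v, hvp, hv0⟩ := p.exists_mem_ne_zero_of_ne_bot
    (by rintro rfl; simpa using hp.2)
  obtain rfl := eq_span_singleton_of_finrank_eq_one hp.2 hvp hv0
  have hthrough : P.flagsGeneratorThrough n J (F ∙ v) = P.flagsThrough J n v := by
    simp only [flagsGeneratorThrough, flagsThrough, Submodule.span_singleton_le_iff_mem]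
  have hn : n ≠ 0 := Nat.one_le_iff_ne_zero.1 (hp.2.ge.trans (hP.1.2 _ hp.1))
  obtain ⟨c, hc⟩ := P.exists_ncard_flagsThrough_eq J n
  have hall := numFlags_mul_pow_sub_one hJ hc
  rw [ncard_singularVectors hP] at hall
  have hq : (Nat.card F : ℝ) ^ n - 1 ≠ 0 :=
    sub_ne_zero.2 (by exact_mod_cast (Nat.one_lt_pow hn Finite.one_lt_card).ne')
  rw [hthrough, hc v ⟨hp.1.1 v hvp, hv0⟩, eq_div_iff (by positivity)]
  exact mul_left_cancel₀ hq (by linear_combination -hall)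

end Finite

end Flags

end PolarForm

section EvenRank

open Module
open LinearMap (BilinForm)

variable {K V : Type*} [Field K] [AddCommGroup V] [Module K V]

/-- The pairs `(a, b) ∈ A × N` with `a + b ∈ M`: with suitable choices of `A`, the domain and the
kernel of `sumForm` are of this kind. -/
def pairsWithSumIn (A N M : Submodule K V) : Submodule K (V × V) :=
  A.prod N ⊓ M.comap (LinearMap.fst K V V + LinearMap.snd K V V)

variable [FiniteDimensional K V]

theorem finrank_pairsWithSumIn {A N M : Submodule K V} (hA : A ≤ N ⊔ M) :
    finrank K (pairsWithSumIn A N M) = finrank K A + finrank K ↥(N ⊓ M) := by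
  let T := pairsWithSumIn A N M
  have hrange : LinearMap.range ((LinearMap.fst K V V).domRestrict T) = A := by
    rw [LinearMap.range_domRestrict]
    ext a
    constructor
    · rintro ⟨ab, hab, rfl⟩
      exact hab.1.1
    · intro ha
      obtain ⟨b, hb, c, hc, rfl⟩ := Submodule.mem_sup.1 (hA ha)
      exact ⟨(b + c, -b), ⟨⟨ha, N.neg_mem hb⟩, by simpa using hc⟩, rfl⟩
  have hker : (LinearMap.ker ((LinearMap.fst K V V).domRestrict T)).map T.subtype =
      (N ⊓ M).map (LinearMap.inr K V V) := by
    ext ab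
    constructor
    · rintro ⟨⟨⟨_, b⟩, hab⟩, rfl : _ = (0 : V), rfl⟩
      exact ⟨b, ⟨hab.1.2, by simpa using hab.2⟩, rfl⟩
    · rintro ⟨b, hb, rfl⟩
      exact ⟨⟨(0, b), ⟨A.zero_mem, hb.1⟩, by simpa using hb.2⟩, rfl, rfl⟩
  rw [← LinearMap.finrank_range_add_finrank_ker ((LinearMap.fst K V V).domRestrict T), hrange,
    ← Submodule.finrank_map_subtype_eq, hker,
    ← (Submodule.equivMapOfInjective _ LinearMap.inr_injective (N ⊓ M)).finrank_eq]

variable {B : BilinForm K V}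

theorem exists_orthogonal_eq_self_of_isAlt (hB : B.IsAlt) : ∃ L, B.orthogonal L = L := by
  obtain ⟨L, hL, hmax⟩ := wellFounded_gt.has_min {L : Submodule K V | L ≤ B.orthogonal L}
    ⟨⊥, show ⊥ ≤ B.orthogonal ⊥ from bot_le⟩
  refine ⟨L, le_antisymm (fun x hx => ?_) hL⟩
  have hsup : L ⊔ K ∙ x ≤ B.orthogonal (L ⊔ K ∙ x) := by
    intro y hy z hz
    obtain ⟨l, hl, _, hcx, rfl⟩ := Submodule.mem_sup.1 hy
    obtain ⟨c, rfl⟩ := Submodule.mem_span_singleton.1 hcx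
    obtain ⟨m, hm, _, hdx, rfl⟩ := Submodule.mem_sup.1 hz
    obtain ⟨d, rfl⟩ := Submodule.mem_span_singleton.1 hdx
    simp [show B m l = 0 from hL hl m hm, show B m x = 0 from hx m hm,
      hB.isRefl l x (hx l hl), hB x]
  have hle : L ⊔ K ∙ x ≤ L := not_lt_iff_le_imp_ge.1 (hmax _ hsup) le_sup_left
  exact hle (Submodule.mem_sup_right (Submodule.mem_span_singleton_self x))

theorem even_finrank_add_finrank_ker_of_isAlt (hB : B.IsAlt) :
    Even (finrank K V + finrank K (LinearMap.ker B)) := by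
  obtain ⟨L, hL⟩ := exists_orthogonal_eq_self_of_isAlt hB
  have hker : LinearMap.ker B ≤ L := fun x hx => hL ▸ fun y _ =>
    hB.isRefl x y (LinearMap.congr_fun hx y)
  have h := B.finrank_add_finrank_orthogonal hB.isRefl L
  rw [hL, B.orthogonal_top_eq_ker hB.isRefl, inf_eq_right.2 hker] at h
  exact ⟨_, h.symm⟩

variable {N₁ N₂ N₃ : Submodule K V}

theorem orthogonal_sup_inf (hB : B.IsRefl) (hnd : B.Nondegenerate) (h₁ : B.orthogonal N₁ = N₁)
    (h₂ : B.orthogonal N₂ = N₂) (h₃ : B.orthogonal N₃ = N₃) :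
    B.orthogonal (N₁ ⊔ N₂ ⊓ N₃) = N₁ ⊓ (N₂ ⊔ N₃) := by
  have hsup (U W : Submodule K V) : B.orthogonal (U ⊔ W) = B.orthogonal U ⊓ B.orthogonal W := by
    refine le_antisymm (le_inf (B.orthogonal_le le_sup_left) (B.orthogonal_le le_sup_right)) ?_
    rintro x ⟨hxU, hxW⟩ z hz
    obtain ⟨u, hu, w, hw, rfl⟩ := Submodule.mem_sup.1 hz
    rw [map_add, LinearMap.add_apply, hxU u hu, hxW w hw, add_zero]
  have hinf : B.orthogonal (N₂ ⊓ N₃) = N₂ ⊔ N₃ := by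
    rw [← B.orthogonal_orthogonal hnd hB (N₂ ⊔ N₃), hsup, h₂, h₃]
  rw [hsup, h₁, hinf]

theorem mem_inf_sup_inf_iff (hB : B.IsRefl) (hnd : B.Nondegenerate) (h₁ : B.orthogonal N₁ = N₁)
    (h₂ : B.orthogonal N₂ = N₂) (h₃ : B.orthogonal N₃ = N₃) {a : V} (ha : a ∈ N₁) :
    a ∈ N₁ ⊓ N₂ ⊔ N₁ ⊓ N₃ ↔ ∀ b ∈ N₂ ⊓ (N₁ ⊔ N₃), B a b = 0 := by
  have hmodular : N₁ ⊓ N₂ ⊔ N₁ ⊓ N₃ = (N₂ ⊔ N₁ ⊓ N₃) ⊓ N₁ := by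
    rw [sup_comm N₂, sup_inf_assoc_of_le _ inf_le_left, inf_comm N₂, sup_comm]
  rw [hmodular, Submodule.mem_inf, and_iff_left ha,
    ← B.orthogonal_orthogonal hnd hB (N₂ ⊔ N₁ ⊓ N₃), orthogonal_sup_inf hB hnd h₂ h₁ h₃]
  exact forall₂_congr fun b _ => ⟨hB b a, hB a b⟩

/-- The form `((a, b), (c, d)) ↦ B a d` of Wall and Kashiwara on the pairs `(a, b) ∈ N₁ × N₂` with
`a + b ∈ N₃`; for these, `a` automatically lies in `N₂ ⊔ N₃`. -/
def sumForm (B : BilinForm K V) (N₁ N₂ N₃ : Submodule K V) :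
    BilinForm K (pairsWithSumIn (N₁ ⊓ (N₂ ⊔ N₃)) N₂ N₃) :=
  (B.compl₁₂ (LinearMap.fst K V V) (LinearMap.snd K V V)).domRestrict₁₂ _ _

theorem map_subtype_ker_sumForm (hB : B.IsRefl) (hnd : B.Nondegenerate)
    (h₁ : B.orthogonal N₁ = N₁) (h₂ : B.orthogonal N₂ = N₂) (h₃ : B.orthogonal N₃ = N₃) :
    (LinearMap.ker (sumForm B N₁ N₂ N₃)).map (Submodule.subtype _) =
      pairsWithSumIn (N₁ ⊓ N₂ ⊔ N₁ ⊓ N₃) N₂ N₃ := by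
  ext ab
  constructor
  · rintro ⟨⟨⟨a, b⟩, hab⟩, hker, rfl⟩
    refine ⟨⟨(mem_inf_sup_inf_iff hB hnd h₁ h₂ h₃ hab.1.1.1).2 ?_, hab.1.2⟩, hab.2⟩
    rintro b' ⟨hb', hsum⟩
    obtain ⟨a', ha', c, hc, rfl⟩ := Submodule.mem_sup.1 hsum
    have hmem : -a' ∈ N₂ ⊔ N₃ :=
      Submodule.mem_sup.2 ⟨_, N₂.neg_mem hb', c, hc, by abel⟩
    exact LinearMap.congr_fun hker
      ⟨(-a', a' + c), ⟨⟨N₁.neg_mem ha', hmem⟩, hb'⟩, by simpa using hc⟩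
  · rcases ab with ⟨a, b⟩
    rintro ⟨⟨ha, hb⟩, hsum⟩
    have hle : N₁ ⊓ N₂ ⊔ N₁ ⊓ N₃ ≤ N₁ ⊓ (N₂ ⊔ N₃) := le_inf_sup
    have haN := hle ha
    refine ⟨⟨(a, b), ⟨haN, hb⟩, hsum⟩, ?_, rfl⟩
    refine LinearMap.ext fun ⟨⟨a', b'⟩, hab'⟩ => ?_
    exact (mem_inf_sup_inf_iff hB hnd h₁ h₂ h₃ haN.1).1 ha b' ⟨hab'.1.2, Submodule.mem_sup.2
      ⟨_, N₁.neg_mem hab'.1.1.1, _, hab'.2, neg_add_cancel_left _ _⟩⟩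

theorem even_finrank_add_sum_finrank_inf (hB : B.IsRefl) (hnd : B.Nondegenerate)
    (h₁ : B.orthogonal N₁ = N₁) (h₂ : B.orthogonal N₂ = N₂) (h₃ : B.orthogonal N₃ = N₃)
    (h : ∀ x ∈ N₁, ∀ y ∈ N₂, x + y ∈ N₃ → B x y = 0) :
    Even (finrank K N₁ + finrank K ↥(N₁ ⊓ N₂) + finrank K ↥(N₁ ⊓ N₃) + finrank K ↥(N₂ ⊓ N₃)) := by
  have halt : (sumForm B N₁ N₂ N₃).IsAlt := fun t => h _ t.2.1.1.1 _ t.2.1.2 t.2.2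
  have heven := even_finrank_add_finrank_ker_of_isAlt halt
  rw [← Submodule.finrank_map_subtype_eq, map_subtype_ker_sumForm hB hnd h₁ h₂ h₃,
    finrank_pairsWithSumIn inf_le_right, finrank_pairsWithSumIn (le_inf_sup.trans inf_le_right)]
    at heven
  have hself := B.finrank_orthogonal hnd N₁
  have horth := B.finrank_orthogonal hnd (N₁ ⊔ N₂ ⊓ N₃)
  rw [h₁] at hself
  rw [orthogonal_sup_inf hB hnd h₁ h₂ h₃] at horth
  have hle := Submodule.finrank_le (N₁ ⊔ N₂ ⊓ N₃)
  have hleN₁ := Submodule.finrank_le N₁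
  have hsup₁ := Submodule.finrank_sup_add_finrank_inf_eq N₁ (N₂ ⊓ N₃)
  have hsup₂ := Submodule.finrank_sup_add_finrank_inf_eq (N₁ ⊓ N₂) (N₁ ⊓ N₃)
  have hinf : N₁ ⊓ N₂ ⊓ (N₁ ⊓ N₃) = N₁ ⊓ (N₂ ⊓ N₃) := inf_inf_distrib_left .. |>.symm
  rw [hinf] at hsup₂
  rw [Nat.even_iff] at heven ⊢
  omega

end EvenRank

namespace PolarForm

section Opposition

variable {F V : Type*} [Field F] [AddCommGroup V] [Module F V] {P : PolarForm F V} {n : ℕ}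
  {J : Set ℕ}

theorem longest_apply (i : Fin n) (s : ℤˣ) : longest n (i, s) = (i, -s) := rfl

theorem IsPolarFrame.disjoint {E : SignedIndex n → Submodule F V} (hE : P.IsPolarFrame n E) :
    Disjoint (⨆ i : Fin n, E (i, 1)) (⨆ i : Fin n, E (i, -1)) := by
  rw [Submodule.disjoint_def]
  intro x hx hx'
  obtain ⟨f, hf, rfl⟩ := (Submodule.mem_iSup_iff_exists_finsupp _ _).1 hx
  rw [Finsupp.sum_fintype _ _ fun _ => rfl] at hx' ⊢
  refine Finset.sum_eq_zero fun j _ => ?_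
  by_contra hj
  -- All summands except the `j`-th are orthogonal to `E (j, -1)`, and so is `x`; hence the `j`-th
  -- summand is too, although it spans the point opposite to `E (j, -1)`.
  have horth : (⨆ i : Fin n, E (i, -1)) ≤ (E (j, -1)).orthogonalBilin P.form :=
    iSup_le fun i z hz y hy => (P.perp_iff y z).1
      ((hE.2 (j, -1) (i, -1)).2 (by simp [longest_apply]) y hy z hz)
  have hform : ∀ y ∈ E (j, -1), P.form y (f j) = 0 := by
    intro y hy
    have hsum : P.form y (∑ i, f i) = 0 := horth hx' y hy
    rw [map_sum, Finset.sum_eq_single_of_mem j (Finset.mem_univ j)] at hsum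
    · exact hsum
    intro i _ hij
    refine (P.perp_iff y (f i)).1 ((hE.2 (j, -1) (i, 1)).2 ?_ y hy (f i) (hf i))
    simpa [longest_apply] using hij
  have hcol : P.Collinear (E (j, -1)) (E (j, 1)) := by
    rw [eq_span_singleton_of_finrank_eq_one (hE.1 (j, 1)).2 (hf j) hj]
    intro y hy z hz
    obtain ⟨c, rfl⟩ := Submodule.mem_span_singleton.1 hz
    rw [perp_iff, map_smul, hform y hy, smul_zero]
  exact (hE.2 (j, -1) (j, 1)).1 hcol (by rw [longest_apply, neg_neg])

theorem IsIsometry.collinear_map_iff {g : V ≃ₗ[F] V} (hg : P.IsIsometry g)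
    {p r : Submodule F V} :
    P.Collinear (p.map (g : V →ₗ[F] V)) (r.map (g : V →ₗ[F] V)) ↔ P.Collinear p r := by
  simp only [Collinear, perp_iff, Submodule.mem_map, LinearEquiv.coe_coe,
    forall_exists_index, and_imp, forall_apply_eq_imp_iff₂, hg.form_eq]

namespace Opposite

variable {f₁ f₂ : Set (Submodule F V)} {N M p r : Submodule F V}

theorem disjoint (h : P.Opposite n J f₁ f₂) (hN : N ∈ f₁) (hM : M ∈ f₂) : Disjoint N M := by
  obtain ⟨-, -, m₁, m₂, -, -, h₁, h₂, E, hE, g, -, rfl, rfl⟩ := h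
  obtain ⟨_, ⟨k, rfl⟩, rfl⟩ := h₁ hN
  obtain ⟨_, ⟨l, rfl⟩, rfl⟩ := h₂ hM
  exact (Submodule.disjoint_map g.injective hE.disjoint).mono
    (Submodule.map_mono (iSup_mono fun i => iSup_le fun _ => le_rfl))
    (Submodule.map_mono (iSup_mono fun i => iSup_le fun _ => le_rfl))

theorem not_collinear [FiniteDimensional F V] (h : P.Opposite n J f₁ f₂) (hp : p ∈ f₁)
    (hr : r ∈ f₂) (hp1 : Module.finrank F p = 1) (hr1 : Module.finrank F r = 1) :
    ¬ P.Collinear p r := by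
  obtain ⟨-, -, m₁, m₂, hm₁, hm₂, h₁, h₂, E, hE, g, hg, rfl, rfl⟩ := h
  have hn : 0 < n := by
    obtain ⟨_, ⟨k, -⟩, -⟩ := h₁ hp
    exact k.pos
  have : NeZero n := ⟨hn.ne'⟩
  have hzero (w : Equiv.Perm (SignedIndex n)) : E (w (0, 1)) ∈ frameFlag E w :=
    ⟨0, by simp [nonpos_iff_eq_zero]⟩
  have hfinrank (i : SignedIndex n) :
      Module.finrank F ((E i).map (g : V →ₗ[F] V)) = 1 :=
    (g.finrank_map_eq (E i)).trans (hE.1 i).2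
  obtain rfl := hm₁.eq_of_finrank_eq (h₁ hp) ⟨_, hzero 1, rfl⟩ (hp1.trans (hfinrank _).symm)
  obtain rfl := hm₂.eq_of_finrank_eq (h₂ hr) ⟨_, hzero (longest n), rfl⟩
    (hr1.trans (hfinrank _).symm)
  exact fun hcol => (hE.2 _ _).1 (hg.collinear_map_iff.1 hcol) rfl

end Opposite

theorem isEKR_flagsPointIn [FiniteDimensional F V] (n : ℕ) (J : Set ℕ) {G : Submodule F V}
    (hG : P.TotallySingular G) : P.IsEKR n J (P.flagsPointIn J G) := by
  refine ⟨fun f hf => hf.1, ?_⟩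
  rintro f₁ ⟨-, p, hp, hp1, hpG⟩ f₂ ⟨-, r, hr, hr1, hrG⟩ h
  exact h.not_collinear hp hr hp1 hr1 fun x hx y hy => hG.2 x (hpG hx) y (hrG hy)

theorem isEKR_flagsGeneratorThrough (n : ℕ) (J : Set ℕ) {p : Submodule F V} (hp : p ≠ ⊥) :
    P.IsEKR n J (P.flagsGeneratorThrough n J p) := by
  refine ⟨fun f hf => hf.1, ?_⟩
  rintro f₁ ⟨-, N, hN, -, hpN⟩ f₂ ⟨-, M, hM, -, hpM⟩ h
  exact hp (le_bot_iff.1 ((h.disjoint hN hM) hpN hpM))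

end Opposition

end PolarForm

section Halving

open Module

theorem two_mul_ncard_sep {α : Type*} {s : Set α} (hs : s.Finite) {p : α → Prop} {φ : α → α}
    (hφ : Set.InjOn φ s) (hmaps : Set.MapsTo φ s s) (hp : ∀ a ∈ s, p (φ a) ↔ ¬ p a) :
    2 * {a ∈ s | p a}.ncard = s.ncard := by
  have hle : {a ∈ s | p a}.ncard ≤ {a ∈ s | ¬ p a}.ncard :=
    Set.ncard_le_ncard_of_injOn φ (fun a ha => ⟨hmaps ha.1, fun h => (hp a ha.1).1 h ha.2⟩)
      (hφ.mono (Set.sep_subset s p)) (hs.subset (Set.sep_subset _ _))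
  have hge : {a ∈ s | ¬ p a}.ncard ≤ {a ∈ s | p a}.ncard :=
    Set.ncard_le_ncard_of_injOn φ (fun a ha => ⟨hmaps ha.1, (hp a ha.1).2 ha.2⟩)
      (hφ.mono (Set.sep_subset s _)) (hs.subset (Set.sep_subset _ _))
  have hadd : {a ∈ s | p a}.ncard + {a ∈ s | ¬ p a}.ncard = s.ncard :=
    Set.ncard_inter_add_ncard_sdiff_eq_ncard s {a | p a} hs
  rw [← hadd, two_mul, hle.antisymm hge]

theorem finrank_inf_map_add_one {K V : Type*} [Field K] [AddCommGroup V] [Module K V]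
    [FiniteDimensional K V] {f : Dual K V} {N : Submodule K V} {g : V ≃ₗ[K] V}
    (hg : ∀ v ∈ N, f v = 0 → g v = v) (hN : N.map (g : V →ₗ[K] V) ≠ N) :
    finrank K ↥(N ⊓ N.map (g : V →ₗ[K] V)) + 1 = finrank K N := by
  have hfinrank : finrank K (N.map (g : V →ₗ[K] V)) = finrank K N := g.finrank_map_eq N
  have hf : f.domRestrict N ≠ 0 := by
    refine fun h => hN (Submodule.eq_of_le_of_finrank_eq ?_ hfinrank)
    rintro _ ⟨v, hv, rfl⟩
    exact (hg v hv (LinearMap.congr_fun h ⟨v, hv⟩)).symm ▸ hv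
  have hle : (LinearMap.ker (f.domRestrict N)).map N.subtype ≤ N ⊓ N.map (g : V →ₗ[K] V) := by
    rintro _ ⟨v, hv, rfl⟩
    exact ⟨v.2, v, v.2, hg v v.2 hv⟩
  have hlt : N ⊓ N.map (g : V →ₗ[K] V) < N := inf_lt_left.2 fun h =>
    hN (Submodule.eq_of_le_of_finrank_eq h hfinrank.symm).symm
  have hker := Dual.finrank_ker_add_one_of_ne_zero hf
  have hle := Submodule.finrank_mono hle
  have hlt := Submodule.finrank_lt_finrank_of_lt hlt
  rw [Submodule.finrank_map_subtype_eq] at hle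
  lia

end Halving

namespace PolarForm

section Hyperbolic

open Module

variable {F V : Type*} [Field F] [AddCommGroup V] [Module F V] {P : PolarForm F V} {n : ℕ}

theorem HasParameter.exists_eq_quadratic (h : P.HasParameter n 0) :
    finrank F V = 2 * n ∧ ∃ Q hQ, P = quadratic Q hQ := by
  cases P <;> norm_num [HasParameter] at h
  exact ⟨h, _, _, rfl⟩

theorem HasParameter.not_singular_sub (hP : P.HasParameter n 0) {x y : V} (hx : P.Singular x)
    (hy : P.Singular y) (hxy : P.form x y ≠ 0) : ¬ P.Singular (x - y) := by
  obtain ⟨-, Q, hQ, rfl⟩ := hP.exists_eq_quadratic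
  intro hsub
  refine hxy ?_
  have hx : Q x = 0 := hx
  have hy : Q y = 0 := hy
  have hsub : Q (x + -y) = 0 := sub_eq_add_neg x y ▸ hsub
  have hpolar : QuadraticMap.polar Q x (-y) = 0 := by
    rw [QuadraticMap.polar, hsub, QuadraticMap.map_neg, hx, hy, sub_zero, sub_zero]
  rwa [QuadraticMap.polar_neg_right, neg_eq_zero] at hpolar

variable [FiniteDimensional F V] {N N₁ N₂ N₃ : Submodule F V}

theorem IsSubspaceOfType.orthogonalBilin_eq (hV : finrank F V = 2 * n)
    (hN : P.IsSubspaceOfType n N) : N.orthogonalBilin P.form = N := by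
  have h := hN.1.finrank_add_finrank_orthogonalBilin
  have hN2 := hN.2
  exact (Submodule.eq_of_le_of_finrank_eq hN.1.le_orthogonalBilin (by lia)).symm

theorem even_add_finrank_inf (hP : P.HasParameter n 0) (h₁ : P.IsSubspaceOfType n N₁)
    (h₂ : P.IsSubspaceOfType n N₂) (h₃ : P.IsSubspaceOfType n N₃) :
    Even (n + finrank F ↥(N₁ ⊓ N₂) + finrank F ↥(N₁ ⊓ N₃) + finrank F ↥(N₂ ⊓ N₃)) := by
  obtain ⟨hV, Q, hQ, rfl⟩ := hP.exists_eq_quadratic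
  have hrefl : Q.polarBilin.IsRefl := (quadratic Q hQ).form_isRefl
  have horth {N : Submodule F V} (hN : (quadratic Q hQ).IsSubspaceOfType n N) :
      LinearMap.BilinForm.orthogonal Q.polarBilin N = N := hN.orthogonalBilin_eq hV
  have hnd : Q.polarBilin.Nondegenerate := hrefl.nondegenerate_iff_separatingLeft.2 fun x hx =>
    hQ x (h₁.1.1 x (horth h₁ ▸ fun y _ => hrefl x y (hx y))) hx
  rw [← h₁.2]
  refine even_finrank_add_sum_finrank_inf hrefl hnd (horth h₁) (horth h₂) (horth h₃) ?_
  intro x hx y hy hxy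
  have hx : Q x = 0 := h₁.1.1 x hx
  have hy : Q y = 0 := h₂.1.1 y hy
  have hxy : Q (x + y) = 0 := h₃.1.1 _ hxy
  simp [QuadraticMap.polar, hx, hy, hxy]

theorem exists_isometry_finrank_inf_map_add_one (hn : n ≠ 0) (hP : P.IsPolarSpace n 0) :
    ∃ g : V ≃ₗ[F] V, P.IsIsometry g ∧ ∀ N, P.IsSubspaceOfType n N →
      finrank F ↥(N ⊓ N.map (g : V →ₗ[F] V)) + 1 = n := by
  obtain ⟨⟨G, hG⟩, -⟩ := hP.1
  obtain ⟨x, hxG, hx0⟩ := G.exists_mem_ne_zero_of_ne_bot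
    (by rintro rfl; exact hn (hG.2.symm.trans (finrank_bot F V)))
  have hx := hG.1.1 x hxG
  obtain ⟨y, hy, hxy⟩ := P.exists_singular_form_ne_zero hx hx0
  obtain ⟨g, hg, hgx, hgfix⟩ := hx.exists_isometry_of_form_ne_zero hy hxy
  have hux : P.form (x - y) x ≠ 0 := by
    rw [map_sub, LinearMap.sub_apply, hx.form_self_eq_zero, zero_sub]
    exact neg_ne_zero.2 (mt (P.form_isRefl y x) hxy)
  -- The reflection `g` fixes the hyperplane `(x - y)⊥` pointwise. It moves every generator `N`,
  -- because `N` is its own orthogonal space and does not contain the nonsingular vector `x - y`.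
  refine ⟨g, hg, fun N hN => ?_⟩
  have huN : x - y ∉ N := fun h => hP.2.not_singular_sub hx hy hxy (hN.1.1 _ h)
  obtain ⟨v, hv, huv⟩ : ∃ v ∈ N, P.form (x - y) v ≠ 0 := by
    by_contra! h
    exact huN (hN.orthogonalBilin_eq hP.2.exists_eq_quadratic.1 ▸
      fun v hv => P.form_isRefl _ _ (h v hv))
  have hgv : g v = v - (P.form (x - y) v / P.form (x - y) x) • (x - y) := by
    have h := hgfix (v - (P.form (x - y) v / P.form (x - y) x) • x)
      (by rw [map_sub, map_smul, smul_eq_mul, div_mul_cancel₀ _ hux, sub_self])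
    rw [map_sub, map_smul, hgx] at h
    rw [smul_sub, sub_eq_iff_eq_add.1 h]
    abel
  rw [finrank_inf_map_add_one (f := P.form (x - y)) (fun w _ => hgfix w), hN.2]
  intro hmap
  have hmem : g v ∈ N := hmap ▸ Submodule.mem_map_of_mem hv
  rw [hgv, Submodule.sub_mem_iff_right N hv] at hmem
  exact huN ((Submodule.smul_mem_iff N (div_ne_zero huv hux)).1 hmem)

theorem IsGeneratorClass.map_mem_iff (hP : P.HasParameter n 0) {K : Set (Submodule F V)}
    (hK : P.IsGeneratorClass n K) {g : V ≃ₗ[F] V} (hg : P.IsIsometry g)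
    (hN : P.IsSubspaceOfType n N) (hgN : finrank F ↥(N ⊓ N.map (g : V →ₗ[F] V)) + 1 = n) :
    N.map (g : V →ₗ[F] V) ∈ K ↔ N ∉ K := by
  obtain ⟨N₀, hN₀, rfl⟩ := hK
  have hmap : P.IsSubspaceOfType n (N.map (g : V →ₗ[F] V)) :=
    ⟨hg.totallySingular_map hN.1, (g.finrank_map_eq N).trans hN.2⟩
  have hparity := even_add_finrank_inf hP hN hmap hN₀
  simp only [Set.mem_ofPred_eq, hN, hmap, true_and, Nat.ModEq]
  rw [Nat.even_iff] at hparity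
  lia

theorem two_mul_ncard_flagsGeneratorIn [Finite F] (hn : n ≠ 0) (hP : P.IsPolarSpace n 0)
    {J : Set ℕ} (hJ : n ∈ J) {K : Set (Submodule F V)} (hK : P.IsGeneratorClass n K) :
    2 * (P.flagsGeneratorIn n J K).ncard = P.numFlags J := by
  have : Finite V := Module.finite_of_finite F
  obtain ⟨g, hg, hgN⟩ := exists_isometry_finrank_inf_map_add_one hn hP
  refine two_mul_ncard_sep (Set.toFinite _)
    (Set.image_injective.2 (Submodule.map_injective_of_injective g.injective)).injOn
    (fun f hf => IsFlag.map hf hg) fun f hf => ?_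
  have hf : P.IsFlag J f := hf
  obtain ⟨N, hN, hNn⟩ := hf.exists_mem hJ
  have hNt : P.IsSubspaceOfType n N := ⟨hf.1 N hN, hNn⟩
  rw [hf.exists_mem_finrank_eq_iff hN hNn, (hf.map hg).exists_mem_finrank_eq_iff
    (Set.mem_image_of_mem _ hN) ((g.finrank_map_eq N).trans hNn)]
  exact hK.map_mem_iff hP.2 hg hNt (hgN N hNt)

theorem isEKR_flagsGeneratorIn (hn : Odd n) (hP : P.HasParameter n 0) (J : Set ℕ)
    {K : Set (Submodule F V)} (hK : P.IsGeneratorClass n K) :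
    P.IsEKR n J (P.flagsGeneratorIn n J K) := by
  obtain ⟨N₀, hN₀, rfl⟩ := hK
  refine ⟨fun f hf => hf.1, ?_⟩
  rintro f₁ ⟨-, N, hN, -, hNt, hNmod⟩ f₂ ⟨-, M, hM, -, hMt, hMmod⟩ h
  have hparity := even_add_finrank_inf hP hNt hMt hN₀
  rw [(h.disjoint hN hM).eq_bot, finrank_bot, Nat.even_iff] at hparity
  rw [Nat.odd_iff] at hn
  rw [Nat.ModEq] at hNmod hMmod
  lia

end Hyperbolic

section EKRBound

variable {F V : Type*} [Field F] [AddCommGroup V] [Module F V] {P : PolarForm F V} {n : ℕ}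
  {e : ℝ} {J : Set ℕ}

theorem ekrBound_eq (h : 1 ≤ e ∨ Even n ∨ n ∉ J) : P.ekrBound n e J =
    P.numFlags J / (1 + (Nat.card F : ℝ) ^ ((n : ℝ) + e - 1)) := by
  have hcase {a : ℝ} (ha : a < 1) : ¬ (Odd n ∧ n ∈ J ∧ e = a) := by
    rintro ⟨hn, hnJ, rfl⟩
    obtain h | h | h := h
    · exact h.not_gt ha
    · exact Nat.not_even_iff_odd.2 hn h
    · exact h hnJ
  rw [ekrBound, if_neg (hcase (by norm_num)), if_neg (hcase zero_lt_one)]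

theorem ekrBound_zero (hn : Odd n) (hJ : n ∈ J) : P.ekrBound n 0 J = P.numFlags J / 2 := by
  rw [ekrBound, if_neg (by norm_num), if_pos ⟨hn, hJ, rfl⟩]

end EKRBound

end PolarForm

theorem mainTheorem9_general {F V : Type*} [Field F] [Finite F] [AddCommGroup V] [Module F V]
    [FiniteDimensional F V] (P : PolarForm F V) (n : ℕ) (e : ℝ)
    (hP : P.IsPolarSpace n e) (J : Set ℕ) :
    (1 ∈ J → ∀ G : Submodule F V, P.IsSubspaceOfType n G →
      P.IsEKR n J (P.flagsPointIn J G) ∧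
      ((P.flagsPointIn J G).ncard : ℝ) =
        (P.numFlags J : ℝ) / (1 + (Nat.card F : ℝ) ^ ((n : ℝ) + e - 1)) ∧
      ((1 ≤ e ∨ Even n ∨ n ∉ J) →
        ((P.flagsPointIn J G).ncard : ℝ) = P.ekrBound n e J)) ∧
    (n ∈ J → (1 ≤ e ∨ Even n) → ∀ p : Submodule F V, P.IsSubspaceOfType 1 p →
      P.IsEKR n J (P.flagsGeneratorThrough n J p) ∧
      ((P.flagsGeneratorThrough n J p).ncard : ℝ) = P.ekrBound n e J) ∧
    (n ∈ J → e = 0 → Odd n → ∀ K : Set (Submodule F V), P.IsGeneratorClass n K →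
      P.IsEKR n J (P.flagsGeneratorIn n J K) ∧
      ((P.flagsGeneratorIn n J K).ncard : ℝ) = P.ekrBound n e J) := by
  refine ⟨fun h1 G hG => ?_, fun hnJ he p hp => ?_, ?_⟩
  · have hcard := PolarForm.ncard_flagsPointIn hP h1 hG
    exact ⟨PolarForm.isEKR_flagsPointIn n J hG.1, hcard,
      fun h => hcard.trans (PolarForm.ekrBound_eq h).symm⟩
  · refine ⟨PolarForm.isEKR_flagsGeneratorThrough n J ?_, ?_⟩
    · rintro rfl
      simpa using hp.2
    · rw [PolarForm.ncard_flagsGeneratorThrough hP hnJ hp,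
        PolarForm.ekrBound_eq (he.imp_right Or.inl)]
  · rintro hnJ rfl hodd K hK
    refine ⟨PolarForm.isEKR_flagsGeneratorIn hodd hP.2 J hK, ?_⟩
    rw [PolarForm.ekrBound_zero hodd hnJ,
      ← PolarForm.two_mul_ncard_flagsGeneratorIn hodd.pos.ne' hP hnJ hK, Nat.cast_mul,
      Nat.cast_ofNat, mul_div_cancel_left₀ _ two_ne_zero]

theorem mainTheorem9 {F V : Type*} [Field F] [Finite F] [AddCommGroup V] [Module F V]
    [FiniteDimensional F V] (P : PolarForm F V) (n : ℕ) (hn : 3 ≤ n) (e : ℝ)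
    (hP : P.IsPolarSpace n e) (J : Set ℕ) (hJ : J ⊆ Set.Icc 1 n) :
    (1 ∈ J → ∀ G : Submodule F V, P.IsSubspaceOfType n G →
      P.IsEKR n J (P.flagsPointIn J G) ∧
      ((P.flagsPointIn J G).ncard : ℝ) =
        (P.numFlags J : ℝ) / (1 + (Nat.card F : ℝ) ^ ((n : ℝ) + e - 1)) ∧
      ((1 ≤ e ∨ Even n ∨ n ∉ J) →
        ((P.flagsPointIn J G).ncard : ℝ) = P.ekrBound n e J)) ∧
    (n ∈ J → (1 ≤ e ∨ Even n) → ∀ p : Submodule F V, P.IsSubspaceOfType 1 p →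
      P.IsEKR n J (P.flagsGeneratorThrough n J p) ∧
      ((P.flagsGeneratorThrough n J p).ncard : ℝ) = P.ekrBound n e J) ∧
    (n ∈ J → e = 0 → Odd n → ∀ K : Set (Submodule F V), P.IsGeneratorClass n K →
      P.IsEKR n J (P.flagsGeneratorIn n J K) ∧
      ((P.flagsGeneratorIn n J K).ncard : ℝ) = P.ekrBound n e J) :=
  mainTheorem9_general P n e hP J
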